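/- Consider a finite distributionally robust Markov game: a finite set of agents $\mathcal N$, a nonempty finite state space $\mathcal S$, nonempty finite action sets $\mathcal A_i$ with $\mathcal A=\prod_{i}\mathcal A_i$, rewards $r_i:\mathcal S\times\mathcal A\to[0,1]$, and an $(s,a)$-rectangular uncertainty set of transition kernels $\mathcal P=\bigotimes_{(s,a)}\mathcal P_s^a$, where each $\mathcal P_s^a\subseteq\Delta(\mathcal S)$ is nonempty, compact and convex. Assume that for every deterministic joint stationary policy and every $\mathsf P\in\mathcal P$ the induced Markov chain on $\mathcal S$ is irreducible. For a stationary product policy $\pi=(\pi_i)_{i\in\mathcal N}$, $\pi_i:\mathcal S\to\Delta(\mathcal A_i)$, and $\gamma\in[0,1)$ let $$V^{\pi}_{\gamma,\mathcal P,i}(s)=\min_{\mathsf P\in\mathcal P}\mathbb E_{\pi,\mathsf P}\Big[\sum_{t\ge 0}\gamma^t r_i(S_t,a_t)\,\Big|\,S_0=s\Big],\qquad g^{\pi}_{\mathcal P,i}(s)=\min_{\mathsf P\in\mathcal P}\ \liminf_{n\to\infty}\mathbb E_{\pi,\mathsf P}\Big[\frac1n\sum_{t<n} r_i(S_t,a_t)\,\Big|\,S_0=s\Big].$$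 Call $\pi$ an $\epsilon$-Nash equilibrium of the $\gamma$-discounted game if $V^{\pi}_{\gamma,\mathcal P,i}(s)+\epsilon\ge V^{(\pi_{-i},\mu_i)}_{\gamma,\mathcal P,i}(s)$ for all $i\in\mathcal N$, $s\in\mathcal S$ and all stationary policies $\mu_i$ of agent $i$; define an $\epsilon$-Nash equilibrium under the average reward in the same way with $g$ in place of $V$. Define the robust diameter $$D=\max_{\mathsf P\in\mathcal P}\ \max_{s,s'\in\mathcal S}\ \min_{\pi}\ \mathbb E\big[T(s'\mid s,\pi,\mathsf P)\big],$$ where $\pi$ ranges over stationary product policies and $T(s'\mid s,\pi,\mathsf P)$ is the first time $t\ge 0$ at which state $s'$ is reached when $\pi$ is executed with kernel $\mathsf P$ from the initial state $s$. Then $D<\infty$, and for every $\epsilon$ with $0<\epsilon\le D$, every $\epsilon$-Nash equilibrium of the $\gamma$-discounted game with discount factor $\gamma=1-\epsilon/D$ is an $\mathcal O(\epsilon)$-Nash equilibrium under the average reward. That is, there is a constant $C>0$, depending only on the state space, the action sets and the uncertainty set $\mathcal P$ (not on $\epsilon$, the rewards, the policy, the agent or the initial state), such that every such equilibrium is a $C\epsilon$-Nash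 equilibrium under the average reward. -/

import Mathlib

open MeasureTheory ProbabilityTheory
open scoped ENNReal

namespace RobustMarkovGame

noncomputable section

variable {ι S : Type*} {A : ι → Type*}

/-- A joint action of all agents. -/
abbrev JointAction (A : ι → Type*) := ∀ i, A i

/-- What happens at one time step: the current state and the joint action taken there. -/
@[ext] structure Step (S : Type*) (A : ι → Type*) where
  state : S
  action : JointAction A

/-- States and actions are finite, so every set of steps is an event. -/
instance : MeasurableSpace (Step S A) := ⊤

instance : DiscreteMeasurableSpace (Step S A) := ⟨fun _ => trivial⟩

instance [Finite ι] [Finite S] [∀ i, Finite (A i)] : Finite (Step S A) :=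
  Finite.of_injective (fun x : Step S A => (x.state, x.action))
    (fun _ _ h => Step.ext (Prod.ext_iff.mp h).1 (Prod.ext_iff.mp h).2)

/-- A transition kernel: `P s a s'` is the probability to move to `s'` when the joint action `a`
is taken in state `s`. -/
abbrev TransitionKernel (S : Type*) [Fintype S] (A : ι → Type*) :=
  S → JointAction A → stdSimplex ℝ S

/-- A stationary (randomized) policy of one agent with action set `B`. -/
abbrev StationaryPolicy (S B : Type*) [Fintype B] := S → stdSimplex ℝ B

/-- A joint stationary product policy: one stationary policy for each agent. -/
abbrev JointPolicy (S : Type*) (A : ι → Type*) [∀ i, Fintype (A i)] :=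
  ∀ i, StationaryPolicy S (A i)

/-- The uncertainty set `⨂_{(s,a)} 𝒫_s^a`, given through its nonempty factors `𝒫_s^a ⊆ Δ(S)`. -/
structure UncertaintySet (S : Type*) [Fintype S] (A : ι → Type*) where
  factor : S → JointAction A → Set (S → ℝ)
  factor_subset : ∀ s a, factor s a ⊆ stdSimplex ℝ S
  factor_nonempty : ∀ s a, (factor s a).Nonempty

/-- The kernels in the uncertainty set: each `P s a` is chosen independently from `𝒫_s^a`. -/
def UncertaintySet.kernels [Fintype S] (U : UncertaintySet S A) : Set (TransitionKernel S A) :=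
  {P | ∀ s a, (P s a : S → ℝ) ∈ U.factor s a}

/-- The state transition matrix induced by a deterministic joint stationary policy `f`. -/
def inducedMatrix [Fintype S] (P : TransitionKernel S A) (f : ∀ i, S → A i) : Matrix S S ℝ :=
  Matrix.of fun s s' => P s (fun i => f i s) s'

/-- The uncertainty set is compact and convex, and every deterministic joint policy induces an
irreducible Markov chain under every kernel of the uncertainty set. -/
structure UncertaintySet.IsRegular [Fintype S] (U : UncertaintySet S A) : Prop where
  isCompact : ∀ s a, IsCompact (U.factor s a)
  convex : ∀ s a, Convex ℝ (U.factor s a)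
  irreducible : ∀ P ∈ U.kernels, ∀ f : ∀ i, S → A i, (inducedMatrix P f).IsIrreducible

section ActionProb

variable [Fintype ι] [∀ i, Fintype (A i)]

/-- The probability that the joint action `a` is taken in state `s`: the agents randomize
independently. -/
def actionProb (π : JointPolicy S A) (s : S) (a : JointAction A) : ℝ := ∏ i, π i s (a i)

lemma actionProb_nonneg (π : JointPolicy S A) (s : S) (a : JointAction A) :
    0 ≤ actionProb π s a :=
  Finset.prod_nonneg fun i _ => (π i s).2.1 (a i)

lemma sum_actionProb [DecidableEq ι] (π : JointPolicy S A) (s : S) :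
    ∑ a, actionProb π s a = 1 := by
  unfold actionProb
  rw [← Fintype.prod_sum (fun i (b : A i) => π i s b)]
  exact Finset.prod_eq_one fun i _ => (π i s).2.2

end ActionProb

section Dynamics

variable [Fintype ι] [DecidableEq ι] [Fintype S] [DecidableEq S] [∀ i, Fintype (A i)]

/-- The law of a step whose state is drawn from `w` and whose joint action is then drawn
from `π`. -/
def stepLaw (π : JointPolicy S A) (w : stdSimplex ℝ S) : Measure (Step S A) :=
  ∑ s, ∑ a, ENNReal.ofReal (w s * actionProb π s a) • Measure.dirac ⟨s, a⟩

instance (π : JointPolicy S A) (w : stdSimplex ℝ S) : IsProbabilityMeasure (stepLaw π w) := by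
  have hw : ∀ s, 0 ≤ w s := w.2.1
  constructor
  simp only [stepLaw, Measure.coe_finsetSum, Finset.sum_apply, Measure.smul_apply, measure_univ,
    smul_eq_mul, mul_one]
  simp_rw [← ENNReal.ofReal_sum_of_nonneg fun a (_ : a ∈ Finset.univ) =>
    mul_nonneg (hw _) (actionProb_nonneg π _ a), ← Finset.mul_sum, sum_actionProb, mul_one]
  rw [← ENNReal.ofReal_sum_of_nonneg fun s _ => hw s]
  have h1 : ∑ s, w s = 1 := w.2.2
  rw [h1, ENNReal.ofReal_one]

/-- The one-step kernel of the state-action process: from `(s, a)`, the next state is drawn from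
`P s a` and the next joint action from `π`. -/
def stepKernel (π : JointPolicy S A) (P : TransitionKernel S A) : Kernel (Step S A) (Step S A) :=
  ⟨fun x => stepLaw π (P x.state x.action), Measurable.of_discrete⟩

instance (π : JointPolicy S A) (P : TransitionKernel S A) : IsMarkovKernel (stepKernel π P) :=
  ⟨fun x => inferInstanceAs (IsProbabilityMeasure (stepLaw π (P x.state x.action)))⟩

/-- The law `ℙ_{π,P}( · | S₀ = s)` of the infinite trajectory `(S₀, a₀), (S₁, a₁), …`. -/
def trajectoryLaw (π : JointPolicy S A) (P : TransitionKernel S A) (s : S) :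
    Measure (ℕ → Step S A) :=
  Kernel.trajMeasure (X := fun _ => Step S A) (stepLaw π (stdSimplex.vertex s))
    (fun n => (stepKernel π P).comap (fun h => h ⟨n, Finset.mem_Iic.2 le_rfl⟩)
      (measurable_pi_apply _))

/-- The discounted value `V^π_P(s) = 𝔼_{π,P}[∑ γ^t r_t | S₀ = s]`. -/
def discountedValue (γ : ℝ) (r : S → JointAction A → ℝ) (π : JointPolicy S A)
    (P : TransitionKernel S A) (s : S) : ℝ :=
  ∫ ω, ∑' t, γ ^ t * r (ω t).state (ω t).action ∂(trajectoryLaw π P s)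

/-- The average reward `g^π_P(s) = liminf_n 𝔼_{π,P}[(1/n) ∑_{t<n} r_t | S₀ = s]`. -/
def averageReward (r : S → JointAction A → ℝ) (π : JointPolicy S A)
    (P : TransitionKernel S A) (s : S) : ℝ :=
  Filter.liminf (fun n : ℕ => ∫ ω, (1 / (n : ℝ)) *
    ∑ t ∈ Finset.range n, r (ω t).state (ω t).action ∂(trajectoryLaw π P s)) Filter.atTop

/-- The first time `T(s')` at which a trajectory is in state `s'` (`⊤` if this never happens);
it is `0` for a trajectory that starts in `s'`. -/
def hittingTime (s' : S) (ω : ℕ → Step S A) : ℝ≥0∞ :=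
  ⨅ (t : ℕ) (_ : (ω t).state = s'), (t : ℝ≥0∞)

namespace UncertaintySet

variable (U : UncertaintySet S A)

/-- The worst-case discounted value over the uncertainty set. -/
def robustDiscountedValue (γ : ℝ) (r : S → JointAction A → ℝ) (π : JointPolicy S A) (s : S) : ℝ :=
  ⨅ P : U.kernels, discountedValue γ r π P.1 s

/-- The worst-case average reward over the uncertainty set. -/
def robustAverageReward (r : S → JointAction A → ℝ) (π : JointPolicy S A) (s : S) : ℝ :=
  ⨅ P : U.kernels, averageReward r π P.1 s

/-- The robust diameter `D = max_P max_{s,s'} min_π 𝔼[T(s' | s, π, P)]`. -/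
def robustDiameter : ℝ≥0∞ :=
  ⨆ P : U.kernels, ⨆ s : S, ⨆ s' : S, ⨅ π : JointPolicy S A,
    ∫⁻ ω, hittingTime s' ω ∂(trajectoryLaw π P.1 s)

/-- `π` is an `ε`-Nash equilibrium of the `γ`-discounted robust game with rewards `r`. -/
def IsDiscountedNash (r : ι → S → JointAction A → ℝ) (γ ε : ℝ) (π : JointPolicy S A) : Prop :=
  ∀ (i : ι) (μ : StationaryPolicy S (A i)) (s : S),
    U.robustDiscountedValue γ (r i) (Function.update π i μ) s ≤
      U.robustDiscountedValue γ (r i) π s + ε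

/-- `π` is an `ε`-Nash equilibrium of the average-reward robust game with rewards `r`. -/
def IsAverageNash (r : ι → S → JointAction A → ℝ) (ε : ℝ) (π : JointPolicy S A) : Prop :=
  ∀ (i : ι) (μ : StationaryPolicy S (A i)) (s : S),
    U.robustAverageReward (r i) (Function.update π i μ) s ≤
      U.robustAverageReward (r i) π s + ε

end UncertaintySet

end Dynamics

end

end RobustMarkovGame

/-! A compact set of irreducible stochastic matrices admits one bound `H` on all its expected
hitting times. Applied to the chains of all joint policies under all kernels of the uncertainty
set, it bounds the robust diameter `D`. It also bounds the span of every discounted value `V`: by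
the Bellman equation, the deficit `max V - V` vanishes at a maximizer of `V` and exceeds its mean
over the next state by at most one, so it is at most the expected hitting time of that maximizer.

Summing the Bellman equation along the chain, the average reward over `n` steps is `1 - γ` times
the average of the expected values at those steps, up to a boundary term of order `1 / n`. Hence the
average reward differs from `(1 - γ) V` by at most `(1 - γ) H`, and this survives the infimum over
kernels. An `ε`-equilibrium of the discounted game is thus a `(1 - γ) (ε + 2 H)`-equilibrium for the
average reward, and `1 - γ = ε / D ≤ 1` gives `(1 - γ) (ε + 2 H) ≤ (1 + 2 H / D) ε`.
-/

namespace RobustMarkovGame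

noncomputable section

section Matrices

lemma length_mapPath {V W : Type*} [Quiver V] [Quiver W] (F : V ⥤q W) {a b : V}
    (p : Quiver.Path a b) : (F.mapPath p).length = p.length := by
  induction p with
  | nil => rfl
  | cons p e ih =>
    rw [Prefunctor.mapPath_cons, Quiver.Path.length_cons, ih, Quiver.Path.length_cons]

open Filter Topology Matrix

variable {S : Type*}

lemma isIrreducible_of_support_subset {A B : Matrix S S ℝ} (hA : A.IsIrreducible)
    (hB : ∀ i j, 0 ≤ B i j) (hAB : ∀ i j, 0 < A i j → 0 < B i j) : B.IsIrreducible := by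
  refine ⟨hB, fun i j => ?_⟩
  obtain ⟨p, hp⟩ := hA.connected i j
  let F := @Prefunctor.mk S A.toQuiver S B.toQuiver id fun e => ⟨hAB _ _ e.down⟩
  exact ⟨@Prefunctor.mapPath _ A.toQuiver _ B.toQuiver F _ _ p,
    (@length_mapPath _ _ A.toQuiver B.toQuiver F _ _ p).symm ▸ hp⟩

variable [Fintype S]

/-- `H` bounds the expected hitting time of every state by the chain with transition matrix `M`,
in variational form: the expected hitting time of `x` is the largest function that vanishes at `x`
and exceeds its mean over the next state by at most one. -/
def IsHittingTimeBound (M : Matrix S S ℝ) (H : ℝ) : Prop :=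
  ∀ (x : S) (u : S → ℝ), u x ≤ 0 → (∀ s, u s ≤ 1 + (M *ᵥ u) s) → ∀ s, u s ≤ H

lemma bellman_of_hasSum [DecidableEq S] {M : Matrix S S ℝ} {γ : ℝ} {ρ V : S → ℝ}
    (hV : HasSum (fun t : ℕ => γ ^ t • (M ^ t *ᵥ ρ)) V) : V = ρ + γ • (M *ᵥ V) := by
  have hnext : HasSum (fun t : ℕ => γ ^ (t + 1) • (M ^ (t + 1) *ᵥ ρ)) (γ • (M *ᵥ V)) := by
    convert (hV.map (mulVecLin M) (by fun_prop)).const_smul γ using 2 with t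
    · simp [mulVec_mulVec, pow_succ', smul_smul]
    · rfl
  simpa using hV.unique hnext.zero_add

variable [DecidableEq S] {M : Matrix S S ℝ} {H : ℝ}

lemma mulVec_mono (hM : M ∈ rowStochastic ℝ S) {u v : S → ℝ} (huv : u ≤ v) :
    M *ᵥ u ≤ M *ᵥ v :=
  fun s => dotProduct_le_dotProduct_of_nonneg_left huv (hM.1 s)

lemma mulVec_const (hM : M ∈ rowStochastic ℝ S) (a : ℝ) : (M *ᵥ fun _ => a) = fun _ => a := by
  ext s
  simp [mulVec, dotProduct, ← Finset.sum_mul, sum_row_of_mem_rowStochastic hM]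

lemma mulVec_apply_le (hM : M ∈ rowStochastic ℝ S) {u : S → ℝ} {a : ℝ} (hu : ∀ s, u s ≤ a)
    (s : S) : (M *ᵥ u) s ≤ a :=
  (mulVec_mono hM hu s).trans_eq (congrFun (mulVec_const hM a) s)

lemma abs_mulVec_sub_le (hM : M ∈ rowStochastic ℝ S) {u : S → ℝ} {a d : ℝ}
    (hu : ∀ s, |u s - a| ≤ d) (s : S) : |(M *ᵥ u) s - a| ≤ d := by
  have hle : (M *ᵥ u) s ≤ a + d := mulVec_apply_le hM (fun s => by linarith [abs_le.1 (hu s)]) s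
  have hge : (M *ᵥ -u) s ≤ -a + d :=
    mulVec_apply_le hM (fun s => by simp only [Pi.neg_apply]; linarith [abs_le.1 (hu s)]) s
  rw [mulVec_neg, Pi.neg_apply] at hge
  exact abs_le.2 ⟨by linarith, by linarith⟩

lemma le_add_pow_mulVec (hM : M ∈ rowStochastic ℝ S) {u : S → ℝ}
    (hu : ∀ s, u s ≤ 1 + (M *ᵥ u) s) (k : ℕ) (s : S) : u s ≤ k + (M ^ k *ᵥ u) s := by
  induction k generalizing s with
  | zero => simp
  | succ k ih =>
    have hstep : (M *ᵥ u) s ≤ k + (M ^ (k + 1) *ᵥ u) s := by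
      have h := mulVec_mono hM (v := (fun _ => (k : ℝ)) + M ^ k *ᵥ u) ih s
      rwa [mulVec_add, mulVec_const hM, mulVec_mulVec, ← pow_succ'] at h
    push_cast
    linarith [hu s]

lemma mulVec_apply_le_of_apply_nonpos (hM : M ∈ rowStochastic ℝ S) {u : S → ℝ} {a : ℝ} {x : S}
    (hx : u x ≤ 0) (hu : ∀ s, u s ≤ a) (y : S) : (M *ᵥ u) y ≤ (1 - M y x) * a := by
  have h := mulVec_apply_le hM (u := u + Pi.single x a) (a := a) (fun s => by
    rcases eq_or_ne s x with rfl | hs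
    · simpa using hx
    · simpa [hs] using hu s) y
  simp only [mulVec_add, mulVec_single, op_smul_eq_smul, Pi.add_apply, Pi.smul_apply, col_apply,
    smul_eq_mul] at h
  linarith

lemma isHittingTimeBound_of_le_pow (hM : M ∈ rowStochastic ℝ S) {n : ℕ} {p : ℝ} (hp : 0 < p)
    (h : ∀ s x, ∃ k ≤ n, p ≤ (M ^ k) s x) : IsHittingTimeBound M (n / p) := by
  intro x u hx hu s
  have : Nonempty S := ⟨s⟩
  obtain ⟨y, hy⟩ := Finite.exists_max u
  refine (hy s).trans ?_
  rcases le_total (u y) 0 with hneg | hpos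
  · exact hneg.trans (by positivity)
  obtain ⟨k, hk, hpk⟩ := h y x
  have hmass : (M ^ k) y x * u y ≤ k := by
    linarith [le_add_pow_mulVec hM hu k y, mulVec_apply_le_of_apply_nonpos (pow_mem hM k) hx hy y]
  rw [le_div_iff₀' hp]
  calc p * u y ≤ (M ^ k) y x * u y := mul_le_mul_of_nonneg_right hpk hpos
    _ ≤ k := hmass
    _ ≤ n := by exact_mod_cast hk

lemma exists_isHittingTimeBound {𝓜 : Set (Matrix S S ℝ)} (hcompact : IsCompact 𝓜)
    (hstoch : ∀ M ∈ 𝓜, M ∈ rowStochastic ℝ S) (hirr : ∀ M ∈ 𝓜, M.IsIrreducible) :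
    ∃ H, 0 ≤ H ∧ ∀ M ∈ 𝓜, IsHittingTimeBound M H := by
  let G (n : ℕ) : Set (Matrix S S ℝ) := {M | ∀ s x, ∃ k ≤ n, 1 / ((n : ℝ) + 1) < (M ^ k) s x}
  have hopen : ∀ n, IsOpen (G n) := fun n => by
    simp only [G, Set.ofPred_forall, Set.ofPred_exists, ← exists_prop]
    exact isOpen_iInter_of_finite fun s => isOpen_iInter_of_finite fun x =>
      isOpen_iUnion fun k => isOpen_iUnion fun _ =>
        isOpen_lt continuous_const ((continuous_pow k).matrix_elem s x)
  have hmono : Monotone G := fun m n hmn M hM s x => by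
    obtain ⟨k, hk, hlt⟩ := hM s x
    exact ⟨k, hk.trans hmn, (Nat.one_div_le_one_div hmn).trans_lt hlt⟩
  have hcover : 𝓜 ⊆ ⋃ n, G n := fun M hM => by
    have hev : ∀ᶠ n in atTop, M ∈ G n := by
      refine eventually_all.2 fun s => eventually_all.2 fun x => ?_
      obtain ⟨k, -, hk⟩ := (isIrreducible_iff_exists_pow_pos (hirr M hM).nonneg).1 (hirr M hM) s x
      filter_upwards [eventually_ge_atTop k,
        tendsto_one_div_add_atTop_nhds_zero_nat.eventually_lt_const hk] with n hn hlt
      exact ⟨k, hn, hlt⟩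
    exact Set.mem_iUnion.2 hev.exists
  obtain ⟨n, hn⟩ := hcompact.elim_directed_cover G hopen hcover hmono.directed_le
  refine ⟨n / (1 / ((n : ℝ) + 1)), by positivity, fun M hM =>
    isHittingTimeBound_of_le_pow (hstoch M hM) (by positivity) fun s x => ?_⟩
  obtain ⟨k, hk, hlt⟩ := hn hM s x
  exact ⟨k, hk, hlt.le⟩

/-- The summands are the probabilities of surviving beyond time `t` when the visit to a state `s`
is survived with probability `c s`. -/
lemma IsHittingTimeBound.sum_killed_le (hH : IsHittingTimeBound M H) (hM : M ∈ rowStochastic ℝ S)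
    {c : S → ℝ} (hc : ∀ s, c s ∈ Set.Icc (0 : ℝ) 1) {x : S} (hx : c x = 0) (n : ℕ) (s : S) :
    ∑ t ∈ Finset.range n, ((diagonal c * M) ^ t *ᵥ c) s ≤ H := by
  set N := diagonal c * M with hN
  have hN_apply : ∀ v s, (N *ᵥ v) s = c s * (M *ᵥ v) s := fun v s => by
    rw [hN, ← mulVec_mulVec, mulVec_diagonal]
  have hnonneg : ∀ t s, 0 ≤ (N ^ t *ᵥ c) s := fun t s =>
    dotProduct_nonneg_of_nonneg (pow_apply_nonneg (fun i j => by
      simpa [hN] using mul_nonneg (hc i).1 (hM.1 i j)) t s) fun s => (hc s).1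
  have hsum_nonneg : ∀ n s, 0 ≤ (∑ t ∈ Finset.range n, N ^ t *ᵥ c) s := fun n s => by
    rw [Finset.sum_apply]
    exact Finset.sum_nonneg fun t _ => hnonneg t s
  have hsucc : ∀ n s, (∑ t ∈ Finset.range (n + 1), N ^ t *ᵥ c) s =
      c s * (1 + (M *ᵥ ∑ t ∈ Finset.range n, N ^ t *ᵥ c) s) := fun n s => by
    rw [Finset.sum_range_succ']
    simp only [pow_succ', ← mulVec_mulVec, ← mulVec_sum, Pi.add_apply, hN_apply, pow_zero,
      one_mulVec]
    ring
  have hmono : ∀ s, (∑ t ∈ Finset.range n, N ^ t *ᵥ c) s ≤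
      (∑ t ∈ Finset.range (n + 1), N ^ t *ᵥ c) s := fun s => by
    rw [Finset.sum_range_succ]
    exact le_add_of_nonneg_right (hnonneg n s)
  rw [← Finset.sum_apply]
  refine hH x _ ((hmono x).trans_eq (by rw [hsucc, hx, zero_mul])) (fun s => ?_) s
  refine (hmono s).trans ((hsucc n s).trans_le (mul_le_of_le_one_left ?_ (hc s).2))
  exact add_nonneg zero_le_one (nonneg_mulVec_of_mem_rowStochastic hM (hsum_nonneg n) s)

variable {γ : ℝ} {ρ V : S → ℝ}

lemma IsHittingTimeBound.sub_le_of_bellman (hH : IsHittingTimeBound M H)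
    (hM : M ∈ rowStochastic ℝ S) (hγ : γ ∈ Set.Icc (0 : ℝ) 1) (hρ : ∀ s, ρ s ∈ Set.Icc (0 : ℝ) 1)
    (hV : V = ρ + γ • (M *ᵥ V)) (s s' : S) : V s - V s' ≤ H := by
  have : Nonempty S := ⟨s⟩
  have hV_apply : ∀ s, V s = ρ s + γ * (M *ᵥ V) s := congrFun hV
  obtain ⟨x, hx⟩ := Finite.exists_max V
  have hMV : ∀ s, (M *ᵥ V) s ≤ V x := mulVec_apply_le hM hx
  have hmax : (1 - γ) * V x ≤ 1 := by
    nlinarith [hV_apply x, mul_le_mul_of_nonneg_left (hMV x) hγ.1, (hρ x).2]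
  have hdeficit := hH x ((fun _ => V x) - V) (by simp) (fun s => by
    rw [mulVec_sub, mulVec_const hM]
    simp only [Pi.sub_apply]
    nlinarith [hV_apply s, mul_le_mul_of_nonneg_left (hMV s) (sub_nonneg.2 hγ.2), (hρ s).1]) s'
  simp only [Pi.sub_apply] at hdeficit
  linarith [hx s]

lemma sum_pow_mulVec_of_bellman (hV : V = ρ + γ • (M *ᵥ V)) (n : ℕ) (s : S) :
    ∑ t ∈ Finset.range n, (M ^ t *ᵥ ρ) s =
      (1 - γ) * ∑ t ∈ Finset.range n, (M ^ t *ᵥ V) s + γ * (V s - (M ^ n *ᵥ V) s) := by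
  induction n with
  | zero => simp
  | succ n ih =>
    have hstep : (M ^ n *ᵥ V) s = (M ^ n *ᵥ ρ) s + γ * (M ^ (n + 1) *ᵥ V) s := by
      conv_lhs => rw [hV]
      rw [mulVec_add, mulVec_smul, mulVec_mulVec, ← pow_succ]
      rfl
    rw [Finset.sum_range_succ, Finset.sum_range_succ, ih]
    linear_combination -hstep

lemma IsHittingTimeBound.abs_average_sub_le (hH : IsHittingTimeBound M H)
    (hM : M ∈ rowStochastic ℝ S) (hγ : γ ∈ Set.Icc (0 : ℝ) 1)
    (hρ : ∀ s, ρ s ∈ Set.Icc (0 : ℝ) 1) (hV : V = ρ + γ • (M *ᵥ V)) (s : S) {n : ℕ} (hn : 0 < n) :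
    |1 / (n : ℝ) * ∑ t ∈ Finset.range n, (M ^ t *ᵥ ρ) s - (1 - γ) * V s| ≤
      (1 - γ) * H + H / n := by
  have hpow : ∀ t, |(M ^ t *ᵥ V) s - V s| ≤ H := fun t =>
    abs_mulVec_sub_le (pow_mem hM t) (fun s' => abs_sub_le_iff.2
      ⟨hH.sub_le_of_bellman hM hγ hρ hV s' s, hH.sub_le_of_bellman hM hγ hρ hV s s'⟩) s
  have hsum : |∑ t ∈ Finset.range n, ((M ^ t *ᵥ V) s - V s)| ≤ n * H := by
    simpa using (Finset.abs_sum_le_sum_abs _ _).trans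
      (Finset.sum_le_card_nsmul (Finset.range n) _ H fun t _ => hpow t)
  have hn' : (0 : ℝ) < n := Nat.cast_pos.2 hn
  have hdecomp : 1 / (n : ℝ) * ∑ t ∈ Finset.range n, (M ^ t *ᵥ ρ) s - (1 - γ) * V s =
      ((1 - γ) * ∑ t ∈ Finset.range n, ((M ^ t *ᵥ V) s - V s) +
        γ * (V s - (M ^ n *ᵥ V) s)) / n := by
    rw [sum_pow_mulVec_of_bellman hV, Finset.sum_sub_distrib, Finset.sum_const, Finset.card_range,
      nsmul_eq_mul]
    field_simp
    ring
  rw [hdecomp, abs_div, abs_of_pos hn', div_le_iff₀ hn']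
  calc |(1 - γ) * ∑ t ∈ Finset.range n, ((M ^ t *ᵥ V) s - V s) + γ * (V s - (M ^ n *ᵥ V) s)|
      ≤ (1 - γ) * |∑ t ∈ Finset.range n, ((M ^ t *ᵥ V) s - V s)| +
          γ * |(M ^ n *ᵥ V) s - V s| := by
        refine (abs_add_le _ _).trans_eq ?_
        rw [abs_mul, abs_mul, abs_of_nonneg (sub_nonneg.2 hγ.2), abs_of_nonneg hγ.1,
          abs_sub_comm (V s)]
    _ ≤ (1 - γ) * (n * H) + 1 * H := by
        gcongr
        exacts [sub_nonneg.2 hγ.2, hγ.2, hpow n]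
    _ = ((1 - γ) * H + H / n) * n := by field_simp

end Matrices

section Reals

open Filter Topology

lemma abs_liminf_sub_le_of_tendsto {α : Type*} {l : Filter α} [l.NeBot] {b δ : α → ℝ} {c d : ℝ}
    (hδ : Tendsto δ l (𝓝 d)) (hb : ∀ᶠ n in l, |b n - c| ≤ δ n) : |liminf b l - c| ≤ d := by
  have hlower : Tendsto (fun n => c - δ n) l (𝓝 (c - d)) := hδ.const_sub c
  have hupper : Tendsto (fun n => c + δ n) l (𝓝 (c + d)) := hδ.const_add c
  have hle : (fun n => c - δ n) ≤ᶠ[l] b := hb.mono fun n hn => by linarith [(abs_le.1 hn).1]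
  have hge : b ≤ᶠ[l] fun n => c + δ n := hb.mono fun n hn => by linarith [(abs_le.1 hn).2]
  have h₁ := liminf_le_liminf hle hlower.isBoundedUnder_ge
    (hupper.isBoundedUnder_le.mono_le hge).isCoboundedUnder_ge
  have h₂ := liminf_le_liminf hge (hlower.isBoundedUnder_ge.mono_ge hle)
    hupper.isBoundedUnder_le.isCoboundedUnder_ge
  rw [hlower.liminf_eq] at h₁
  rw [hupper.liminf_eq] at h₂
  exact abs_sub_le_iff.2 ⟨by linarith, by linarith⟩

lemma abs_ciInf_sub_ciInf_le {κ : Type*} [Nonempty κ] {f g : κ → ℝ} {d : ℝ}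
    (hg : BddBelow (Set.range g)) (h : ∀ k, |f k - g k| ≤ d) : |(⨅ k, f k) - ⨅ k, g k| ≤ d := by
  have hf : BddBelow (Set.range f) := by
    obtain ⟨b, hb⟩ := hg
    refine ⟨b - d, Set.forall_mem_range.2 fun k => ?_⟩
    linarith [hb ⟨k, rfl⟩, (abs_le.1 (h k)).1]
  have h₁ : (⨅ k, f k) - d ≤ ⨅ k, g k := le_ciInf fun k => by
    linarith [ciInf_le hf k, (abs_le.1 (h k)).2]
  have h₂ : (⨅ k, g k) - d ≤ ⨅ k, f k := le_ciInf fun k => by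
    linarith [ciInf_le hg k, (abs_le.1 (h k)).1]
  exact abs_sub_le_iff.2 ⟨by linarith, by linarith⟩

end Reals

section Trajectories

open Matrix

variable {ι S : Type*} {A : ι → Type*}
variable [Fintype ι] [DecidableEq ι] [∀ i, Fintype (A i)]

/-- The mean of `f s a` when the joint action `a` is drawn from `π` in state `s`. -/
def policyMean (π : JointPolicy S A) (f : S → JointAction A → ℝ) (s : S) : ℝ :=
  ∑ a, actionProb π s a * f s a

lemma policyMean_mul_left (π : JointPolicy S A) (c : S → ℝ) (f : S → JointAction A → ℝ) :
    policyMean π (fun s a => c s * f s a) = c * policyMean π f := by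
  ext s
  simp only [policyMean, Pi.mul_apply, Finset.mul_sum, mul_left_comm]

lemma policyMean_const (π : JointPolicy S A) (c : ℝ) :
    policyMean π (fun _ _ => c) = fun _ => c := by
  ext s
  rw [policyMean, ← Finset.sum_mul, sum_actionProb, one_mul]

lemma policyMean_mem_Icc (π : JointPolicy S A) {f : S → JointAction A → ℝ}
    (hf : ∀ s a, f s a ∈ Set.Icc (0 : ℝ) 1) (s : S) : policyMean π f s ∈ Set.Icc (0 : ℝ) 1 := by
  refine ⟨Finset.sum_nonneg fun a _ => mul_nonneg (actionProb_nonneg π s a) (hf s a).1, ?_⟩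
  rw [← sum_actionProb π s]
  exact Finset.sum_le_sum fun a _ => mul_le_of_le_one_right (actionProb_nonneg π s a) (hf s a).2

variable [Fintype S]

/-- The state transition matrix induced by a joint stationary policy. -/
def transitionMatrix (π : JointPolicy S A) (P : TransitionKernel S A) : Matrix S S ℝ :=
  Matrix.of fun s s' => policyMean π (fun s a => P s a s') s

lemma policyMean_sum_mul (π : JointPolicy S A) (P : TransitionKernel S A) (v : S → ℝ) :
    policyMean π (fun s a => ∑ s', P s a s' * v s') = transitionMatrix π P *ᵥ v := by
  ext s
  simp only [policyMean, mulVec, dotProduct, transitionMatrix, of_apply, Finset.mul_sum,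
    Finset.sum_mul, mul_assoc]
  exact Finset.sum_comm

lemma integral_stepLaw (π : JointPolicy S A) (w : stdSimplex ℝ S) (f : S → JointAction A → ℝ) :
    ∫ x, f x.state x.action ∂(stepLaw π w) = ∑ s, w s * policyMean π f s := by
  have hw : ∀ s, 0 ≤ w s := w.2.1
  have hint : ∀ s a, Integrable (fun x : Step S A => f x.state x.action)
      (ENNReal.ofReal (w s * actionProb π s a) • Measure.dirac ⟨s, a⟩) :=
    fun s a => Integrable.of_finite.smul_measure ENNReal.ofReal_ne_top
  unfold stepLaw
  rw [integral_finsetSum_measure fun s _ => integrable_finsetSum_measure.2 fun a _ => hint s a]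
  refine Finset.sum_congr rfl fun s _ => ?_
  rw [integral_finsetSum_measure fun a _ => hint s a, policyMean, Finset.mul_sum]
  refine Finset.sum_congr rfl fun a _ => ?_
  rw [integral_smul_measure, integral_dirac, smul_eq_mul,
    ENNReal.toReal_ofReal (mul_nonneg (hw s) (actionProb_nonneg π s a)), mul_assoc]

variable [DecidableEq S]

lemma transitionMatrix_mem_rowStochastic (π : JointPolicy S A) (P : TransitionKernel S A) :
    transitionMatrix π P ∈ rowStochastic ℝ S := by
  refine ⟨fun s s' => Finset.sum_nonneg fun a _ =>
    mul_nonneg (actionProb_nonneg π s a) ((P s a).2.1 s'), ?_⟩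
  have hP : ∀ s a, ∑ s', P s a s' = 1 := fun s a => (P s a).2.2
  rw [← policyMean_sum_mul]
  simp only [Pi.one_apply, mul_one, hP, policyMean_const]
  rfl

instance (π : JointPolicy S A) (P : TransitionKernel S A) (s : S) :
    IsProbabilityMeasure (trajectoryLaw π P s) := by
  unfold trajectoryLaw
  infer_instance

lemma map_eval_zero_trajectoryLaw (π : JointPolicy S A) (P : TransitionKernel S A) (s : S) :
    (trajectoryLaw π P s).map (fun ω => ω 0) = stepLaw π (stdSimplex.vertex s) := by
  have hcomp : (fun ω : ℕ → Step S A => ω 0) =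
      (fun h : Finset.Iic 0 → Step S A => h ⟨0, Finset.mem_Iic.2 le_rfl⟩) ∘
        Preorder.frestrictLe (π := fun _ => Step S A) 0 := rfl
  rw [hcomp, ← Measure.map_map (by fun_prop) (by fun_prop), trajectoryLaw, Kernel.trajMeasure,
    Measure.map_comp _ _ (by fun_prop), Kernel.traj_map_frestrictLe, Kernel.partialTraj_self,
    Measure.id_comp, Measure.map_map (by fun_prop) (by fun_prop)]
  exact Measure.map_id

variable (π : JointPolicy S A) (P : TransitionKernel S A) (s : S)

lemma integral_trajectoryLaw_zero (f : S → JointAction A → ℝ) :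
    ∫ ω, f (ω 0).state (ω 0).action ∂(trajectoryLaw π P s) = policyMean π f s := by
  have h := integral_stepLaw π (stdSimplex.vertex s) f
  rw [← map_eval_zero_trajectoryLaw π P, integral_map
    (measurable_pi_apply 0).aemeasurable Measurable.of_discrete.aestronglyMeasurable] at h
  rw [h]
  simp [stdSimplex.vertex_coe, Pi.single_apply]

lemma integral_trajectoryLaw_succ (n : ℕ) (G : (Finset.Iic n → Step S A) → ℝ)
    (f : S → JointAction A → ℝ) :
    ∫ ω, G (Preorder.frestrictLe n ω) * f (ω (n + 1)).state (ω (n + 1)).action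
        ∂(trajectoryLaw π P s) =
      ∫ ω, G (Preorder.frestrictLe n ω) *
        ∑ s', P (ω n).state (ω n).action s' * policyMean π f s' ∂(trajectoryLaw π P s) := by
  have hmarkov := Kernel.map_frestrictLe_trajMeasure_compProd_eq_map_trajMeasure
    (X := fun _ => Step S A) (μ₀ := stepLaw π (stdSimplex.vertex s))
    (κ := fun n => (stepKernel π P).comap (fun h => h ⟨n, Finset.mem_Iic.2 le_rfl⟩)
      (measurable_pi_apply _)) (a := n)
  calc _ = ∫ x, G x.1 * f x.2.state x.2.action ∂((trajectoryLaw π P s).map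
        (fun ω => (Preorder.frestrictLe (π := fun _ => Step S A) n ω, ω (n + 1)))) := by
        rw [integral_map (by fun_prop) Measurable.of_discrete.aestronglyMeasurable]
    _ = _ := by
        rw [trajectoryLaw, ← hmarkov, Measure.integral_compProd Integrable.of_finite,
          integral_map (by fun_prop) Measurable.of_discrete.aestronglyMeasurable]
        refine integral_congr_ae (.of_forall fun ω => ?_)
        simp only [integral_const_mul]
        exact congrArg _ (integral_stepLaw π _ f)

lemma integral_prod_mul_trajectoryLaw (c : S → ℝ) (n : ℕ) (f : S → JointAction A → ℝ) :
    ∫ ω, (∏ i ∈ Finset.Iic n, c (ω i).state) * f (ω n).state (ω n).action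
        ∂(trajectoryLaw π P s) =
      ((diagonal c * transitionMatrix π P) ^ n *ᵥ (c * policyMean π f)) s := by
  induction n generalizing f with
  | zero =>
    rw [pow_zero, one_mulVec, ← policyMean_mul_left, ← integral_trajectoryLaw_zero π P s]
    simp only [← Nat.range_succ_eq_Iic, zero_add, Finset.prod_range_one]
  | succ n ih =>
    have hcond := integral_trajectoryLaw_succ π P s n
      (fun h => ∏ i : Finset.Iic n, c (h i).state) (fun s a => c s * f s a)
    have hprod (ω : ℕ → Step S A) : ∏ i : Finset.Iic n, c (ω i).state =
        ∏ i ∈ Finset.Iic n, c (ω i).state :=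
      Finset.prod_coe_sort (Finset.Iic n) fun i => c (ω i).state
    simp only [Preorder.frestrictLe_apply, hprod] at hcond
    simp only [← Nat.range_succ_eq_Iic] at hcond ih ⊢
    simp_rw [Finset.prod_range_succ _ (n + 1), mul_assoc]
    rw [hcond, ih fun s a => ∑ s', P s a s' * policyMean π (fun s a => c s * f s a) s',
      policyMean_sum_mul, policyMean_mul_left, pow_succ, ← mulVec_mulVec, ← mulVec_mulVec]
    congr 2
    ext s
    rw [mulVec_diagonal, Pi.mul_apply]

lemma integral_trajectoryLaw (f : S → JointAction A → ℝ) (n : ℕ) :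
    ∫ ω, f (ω n).state (ω n).action ∂(trajectoryLaw π P s) =
      (transitionMatrix π P ^ n *ᵥ policyMean π f) s := by
  simpa using integral_prod_mul_trajectoryLaw π P s 1 n f

lemma integrable_trajectoryLaw (f : S → JointAction A → ℝ) (n : ℕ) :
    Integrable (fun ω => f (ω n).state (ω n).action) (trajectoryLaw π P s) :=
  Integrable.comp_measurable (μ := trajectoryLaw π P s) (f := fun ω : ℕ → Step S A => ω n)
    (g := fun x => f x.state x.action) .of_finite (measurable_pi_apply n)

end Trajectories

section Values

open Filter Topology Matrix

variable {ι S : Type*} {A : ι → Type*} [Fintype S]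

lemma UncertaintySet.nonempty_kernels (U : UncertaintySet S A) : U.kernels.Nonempty := by
  choose f hf using U.factor_nonempty
  exact ⟨fun s a => ⟨f s a, U.factor_subset s a (hf s a)⟩, hf⟩

variable [Fintype ι] [DecidableEq ι] [∀ i, Fintype (A i)] [DecidableEq S]
variable {γ : ℝ} {r : S → JointAction A → ℝ}

lemma hasSum_discountedValue (hγ : γ ∈ Set.Ico (0 : ℝ) 1) (hr : ∀ s a, r s a ∈ Set.Icc (0 : ℝ) 1)
    (π : JointPolicy S A) (P : TransitionKernel S A) :
    HasSum (fun t => γ ^ t • (transitionMatrix π P ^ t *ᵥ policyMean π r))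
      (discountedValue γ r π P) := by
  refine Pi.hasSum.2 fun s => ?_
  have hint : ∀ t, Integrable (fun ω => γ ^ t * r (ω t).state (ω t).action)
      (trajectoryLaw π P s) := fun t => (integrable_trajectoryLaw π P s r t).const_mul _
  have hbound : ∀ t (ω : ℕ → Step S A), ‖γ ^ t * r (ω t).state (ω t).action‖ ≤ γ ^ t :=
    fun t ω => by
      have hrω := hr (ω t).state (ω t).action
      rw [Real.norm_of_nonneg (mul_nonneg (pow_nonneg hγ.1 t) hrω.1)]
      exact mul_le_of_le_one_right (pow_nonneg hγ.1 t) hrω.2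
  have hsummable : Summable fun t =>
      ∫ ω, ‖γ ^ t * r (ω t).state (ω t).action‖ ∂(trajectoryLaw π P s) :=
    .of_nonneg_of_le (fun t => integral_nonneg fun ω => norm_nonneg _)
      (fun t => (integral_mono (hint t).norm (integrable_const _) (hbound t)).trans_eq (by simp))
      (summable_geometric_of_lt_one hγ.1 hγ.2)
  have h := hasSum_integral_of_summable_integral_norm hint hsummable
  simp only [integral_const_mul, integral_trajectoryLaw] at h
  exact h

lemma discountedValue_nonneg (hγ : 0 ≤ γ) (hr : ∀ s a, 0 ≤ r s a) (π : JointPolicy S A)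
    (P : TransitionKernel S A) (s : S) : 0 ≤ discountedValue γ r π P s :=
  integral_nonneg fun _ => tsum_nonneg fun t => mul_nonneg (pow_nonneg hγ t) (hr _ _)

lemma averageReward_eq_liminf (r : S → JointAction A → ℝ) (π : JointPolicy S A)
    (P : TransitionKernel S A) (s : S) :
    averageReward r π P s = liminf (fun n : ℕ => 1 / (n : ℝ) *
      ∑ t ∈ Finset.range n, (transitionMatrix π P ^ t *ᵥ policyMean π r) s) atTop := by
  unfold averageReward
  congr! 2 with n
  rw [integral_const_mul, integral_finsetSum _ fun t _ => integrable_trajectoryLaw π P s r t]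
  simp only [integral_trajectoryLaw]

lemma abs_averageReward_sub_le {P : TransitionKernel S A} {π : JointPolicy S A} {H : ℝ}
    (hH : IsHittingTimeBound (transitionMatrix π P) H) (hγ : γ ∈ Set.Ico (0 : ℝ) 1)
    (hr : ∀ s a, r s a ∈ Set.Icc (0 : ℝ) 1) (s : S) :
    |averageReward r π P s - (1 - γ) * discountedValue γ r π P s| ≤ (1 - γ) * H := by
  have hlim : Tendsto (fun n : ℕ => (1 - γ) * H + H / n) atTop
      (𝓝 ((1 - γ) * H)) := by
    simpa using (tendsto_const_div_atTop_nhds_zero_nat H).const_add ((1 - γ) * H)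
  rw [averageReward_eq_liminf]
  refine abs_liminf_sub_le_of_tendsto hlim ?_
  filter_upwards [eventually_gt_atTop 0] with n hn
  exact hH.abs_average_sub_le (transitionMatrix_mem_rowStochastic π P) (Set.Ico_subset_Icc_self hγ)
    (policyMean_mem_Icc π hr) (bellman_of_hasSum (hasSum_discountedValue hγ hr π P)) s hn

lemma abs_robustAverageReward_sub_le {U : UncertaintySet S A} {π : JointPolicy S A} {H : ℝ}
    (hH : ∀ P ∈ U.kernels, IsHittingTimeBound (transitionMatrix π P) H)
    (hγ : γ ∈ Set.Ico (0 : ℝ) 1) (hr : ∀ s a, r s a ∈ Set.Icc (0 : ℝ) 1) (s : S) :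
    |U.robustAverageReward r π s - (1 - γ) * U.robustDiscountedValue γ r π s| ≤ (1 - γ) * H := by
  have := U.nonempty_kernels.to_subtype
  have hγ' : 0 ≤ 1 - γ := sub_nonneg.2 hγ.2.le
  rw [UncertaintySet.robustDiscountedValue, Real.mul_iInf_of_nonneg hγ']
  refine abs_ciInf_sub_ciInf_le ⟨0, Set.forall_mem_range.2 fun P => ?_⟩
    fun P => abs_averageReward_sub_le (hH P.1 P.2) hγ hr s
  exact mul_nonneg hγ' (discountedValue_nonneg hγ.1 (fun s a => (hr s a).1) π P.1 s)

variable {U : UncertaintySet S A} {r : ι → S → JointAction A → ℝ} {ε δ H : ℝ}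
  {π : JointPolicy S A}

lemma UncertaintySet.IsAverageNash.mono (hπ : U.IsAverageNash r ε π) (h : ε ≤ δ) :
    U.IsAverageNash r δ π :=
  fun i μ s => (hπ i μ s).trans (by gcongr)

lemma UncertaintySet.IsDiscountedNash.isAverageNash
    (hH : ∀ P ∈ U.kernels, ∀ π, IsHittingTimeBound (transitionMatrix π P) H)
    (hγ : γ ∈ Set.Ico (0 : ℝ) 1) (hr : ∀ i s a, r i s a ∈ Set.Icc (0 : ℝ) 1)
    (hπ : U.IsDiscountedNash r γ ε π) : U.IsAverageNash r ((1 - γ) * (ε + 2 * H)) π := by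
  intro i μ s
  have happrox := fun π => abs_le.1 <|
    abs_robustAverageReward_sub_le (fun P hP => hH P hP π) hγ (hr i) s
  have hnash := mul_le_mul_of_nonneg_left (hπ i μ s) (sub_nonneg.2 hγ.2.le)
  linarith [(happrox (Function.update π i μ)).2, (happrox π).1]

end Values

section Diameter

open Matrix

variable {ι S : Type*} {A : ι → Type*}

/-- The event that a trajectory does not visit `x` up to and including time `t`. -/
def avoidsThrough (x : S) (t : ℕ) : Set (ℕ → Step S A) := {ω | ∀ i ≤ t, (ω i).state ≠ x}

lemma measurableSet_avoidsThrough (x : S) (t : ℕ) :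
    MeasurableSet (avoidsThrough x t : Set (ℕ → Step S A)) := by
  simp only [avoidsThrough, Set.ofPred_forall]
  exact .iInter fun i => .iInter fun _ =>
    (MeasurableSet.of_discrete (s := {y : Step S A | y.state ≠ x})).preimage
      (measurable_pi_apply i)

lemma prod_indicator_compl_singleton (x : S) (t : ℕ) (ω : ℕ → Step S A) :
    ∏ i ∈ Finset.Iic t, Set.indicator {x}ᶜ (1 : S → ℝ) (ω i).state =
      (avoidsThrough x t).indicator 1 ω := by
  classical
  simp only [Set.indicator_apply, Set.mem_compl_singleton_iff, Pi.one_apply,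
    Finset.prod_ite_zero, Finset.mem_Iic, Finset.prod_const_one, avoidsThrough,
    Set.mem_ofPred_eq]

lemma hittingTime_le_tsum (x : S) (ω : ℕ → Step S A) :
    hittingTime x ω ≤ ∑' t, (avoidsThrough x t).indicator 1 ω := by
  classical
  have hone {t : ℕ} (ht : ∀ i ≤ t, (ω i).state ≠ x) :
      (avoidsThrough x t).indicator 1 ω = (1 : ℝ≥0∞) :=
    Set.indicator_of_mem (s := avoidsThrough x t) ht _
  by_cases h : ∃ t, (ω t).state = x
  · calc hittingTime x ω ≤ (Nat.find h : ℝ≥0∞) := iInf₂_le (Nat.find h) (Nat.find_spec h)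
      _ = ∑ t ∈ Finset.range (Nat.find h), 1 := by simp
      _ = ∑ t ∈ Finset.range (Nat.find h), (avoidsThrough x t).indicator 1 ω :=
        Finset.sum_congr rfl fun t ht => (hone fun i hi =>
          Nat.find_min h (hi.trans_lt (Finset.mem_range.1 ht))).symm
      _ ≤ _ := ENNReal.sum_le_tsum _
  · push Not at h
    simp only [hone fun i _ => h i, ENNReal.tsum_const_eq_top_of_ne_zero one_ne_zero, le_top]

variable [Fintype ι] [DecidableEq ι] [Fintype S] [DecidableEq S] [∀ i, Fintype (A i)]

lemma measureReal_avoidsThrough (π : JointPolicy S A) (P : TransitionKernel S A) (s x : S)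
    (t : ℕ) :
    (trajectoryLaw π P s).real (avoidsThrough x t) =
      ((diagonal (Set.indicator {x}ᶜ 1) * transitionMatrix π P) ^ t *ᵥ
        Set.indicator {x}ᶜ 1) s := by
  have h := integral_prod_mul_trajectoryLaw π P s (Set.indicator {x}ᶜ 1) t fun _ _ => 1
  simp only [prod_indicator_compl_singleton, mul_one, policyMean_const,
    integral_indicator_one (measurableSet_avoidsThrough x t)] at h
  exact h.trans (by rw [← Pi.one_def, mul_one])

lemma lintegral_hittingTime_le {P : TransitionKernel S A} {π : JointPolicy S A} {H : ℝ}
    (hH : IsHittingTimeBound (transitionMatrix π P) H) (s x : S) :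
    ∫⁻ ω, hittingTime x ω ∂(trajectoryLaw π P s) ≤ ENNReal.ofReal H := by
  have hc : ∀ y, Set.indicator {x}ᶜ (1 : S → ℝ) y ∈ Set.Icc (0 : ℝ) 1 := fun y =>
    ⟨Set.indicator_nonneg (fun _ _ => zero_le_one) y,
      Set.indicator_le_self' (fun _ _ => zero_le_one) y⟩
  calc ∫⁻ ω, hittingTime x ω ∂(trajectoryLaw π P s)
      ≤ ∫⁻ ω, ∑' t, (avoidsThrough x t).indicator 1 ω ∂(trajectoryLaw π P s) :=
        lintegral_mono (hittingTime_le_tsum x)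
    _ = ∑' t, ENNReal.ofReal ((trajectoryLaw π P s).real (avoidsThrough x t)) := by
        rw [lintegral_tsum fun t =>
          (measurable_one.indicator (measurableSet_avoidsThrough x t)).aemeasurable]
        exact tsum_congr fun t => by
          rw [lintegral_indicator_one (measurableSet_avoidsThrough x t), ofReal_measureReal]
    _ ≤ ENNReal.ofReal H := ENNReal.tsum_eq_iSup_nat.trans_le <| iSup_le fun n => by
        rw [← ENNReal.ofReal_sum_of_nonneg fun _ _ => measureReal_nonneg]
        simp only [measureReal_avoidsThrough]
        exact ENNReal.ofReal_le_ofReal (hH.sum_killed_le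
          (transitionMatrix_mem_rowStochastic π P) hc (x := x) (by simp) n s)

lemma robustDiameter_le {U : UncertaintySet S A} {H : ℝ}
    (hH : ∀ P ∈ U.kernels, ∃ π, IsHittingTimeBound (transitionMatrix π P) H) :
    U.robustDiameter ≤ ENNReal.ofReal H := by
  refine iSup_le fun P => iSup_le fun s => iSup_le fun x => ?_
  obtain ⟨π, hπ⟩ := hH P.1 P.2
  exact iInf_le_of_le π (lintegral_hittingTime_le hπ s x)

end Diameter

section Regular

open Matrix

variable {ι S : Type*} {A : ι → Type*}

lemma exists_actionProb_pos [Fintype ι] [∀ i, Fintype (A i)] (π : JointPolicy S A) (s : S) :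
    ∃ a, 0 < actionProb π s a := by
  classical
  obtain ⟨a, -, ha⟩ := Finset.exists_lt_of_sum_lt (s := Finset.univ) (f := fun _ => 0)
    (g := actionProb π s) (by simp [sum_actionProb])
  exact ⟨a, ha⟩

variable [Fintype S]

lemma UncertaintySet.isCompact_kernels {U : UncertaintySet S A}
    (hU : ∀ s a, IsCompact (U.factor s a)) : IsCompact U.kernels := by
  refine IsClosed.isCompact ?_
  simp only [UncertaintySet.kernels, Set.ofPred_forall]
  exact isClosed_iInter fun s => isClosed_iInter fun a =>
    (hU s a).isClosed.preimage (by fun_prop)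

variable [Fintype ι] [DecidableEq ι] [∀ i, Fintype (A i)]

lemma isIrreducible_transitionMatrix {P : TransitionKernel S A}
    (hirr : ∀ f : ∀ i, S → A i, (inducedMatrix P f).IsIrreducible) (π : JointPolicy S A) :
    (transitionMatrix π P).IsIrreducible := by
  choose f hf using exists_actionProb_pos π
  have hterm : ∀ s s' a, 0 ≤ actionProb π s a * P s a s' := fun s s' a =>
    mul_nonneg (actionProb_nonneg π s a) ((P s a).2.1 s')
  exact isIrreducible_of_support_subset (hirr fun i s => f s i)
    (fun s s' => Finset.sum_nonneg fun a _ => hterm s s' a)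
    fun s s' h => Finset.sum_pos' (fun a _ => hterm s s' a)
      ⟨f s, Finset.mem_univ _, mul_pos (hf s) h⟩

lemma continuous_transitionMatrix :
    Continuous fun p : JointPolicy S A × TransitionKernel S A => transitionMatrix p.1 p.2 := by
  refine continuous_matrix fun s s' => continuous_finsetSum _ fun a _ => Continuous.mul ?_ ?_
  · refine continuous_finsetProd _ fun i _ => ?_
    exact (continuous_apply (a i)).comp (continuous_subtype_val.comp
      ((continuous_apply s).comp ((continuous_apply i).comp continuous_fst)))
  · exact (continuous_apply s').comp (continuous_subtype_val.comp
      ((continuous_apply a).comp ((continuous_apply s).comp continuous_snd)))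

lemma exists_isHittingTimeBound_transitionMatrix {U : UncertaintySet S A}
    (hcompact : ∀ s a, IsCompact (U.factor s a))
    (hirr : ∀ P ∈ U.kernels, ∀ f : ∀ i, S → A i, (inducedMatrix P f).IsIrreducible) :
    ∃ H, 0 ≤ H ∧ ∀ P ∈ U.kernels, ∀ π, IsHittingTimeBound (transitionMatrix π P) H := by
  classical
  have hkernels : IsCompact U.kernels := UncertaintySet.isCompact_kernels hcompact
  obtain ⟨H, hH, hbound⟩ := exists_isHittingTimeBound
    ((isCompact_univ.prod hkernels).image continuous_transitionMatrix)
    (Set.forall_mem_image.2 fun p _ => transitionMatrix_mem_rowStochastic p.1 p.2)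
    (Set.forall_mem_image.2 fun p hp => isIrreducible_transitionMatrix (hirr p.2 hp.2) p.1)
  exact ⟨H, hH, fun P hP π => hbound _ (Set.mem_image_of_mem _ (x := (π, P)) ⟨trivial, hP⟩)⟩

end Regular

end

end RobustMarkovGame

theorem mainTheorem7_general {ι S : Type*} [Fintype ι] [DecidableEq ι] [Fintype S]
    [DecidableEq S] {A : ι → Type*} [∀ i, Fintype (A i)] [∀ i, Nonempty (A i)]
    (U : RobustMarkovGame.UncertaintySet S A) (hcompact : ∀ s a, IsCompact (U.factor s a))
    (hirr : ∀ P ∈ U.kernels, ∀ f : ∀ i, S → A i,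
      (RobustMarkovGame.inducedMatrix P f).IsIrreducible) :
    U.robustDiameter ≠ ⊤ ∧
    ∃ C : ℝ, 0 < C ∧
      ∀ r : ι → S → RobustMarkovGame.JointAction A → ℝ,
        (∀ i s a, r i s a ∈ Set.Icc (0 : ℝ) 1) →
        ∀ ε : ℝ, 0 < ε → ε ≤ U.robustDiameter.toReal →
          ∀ π : RobustMarkovGame.JointPolicy S A,
            U.IsDiscountedNash r (1 - ε / U.robustDiameter.toReal) ε π →
            U.IsAverageNash r (C * ε) π := by
  obtain ⟨H, hH, hbound⟩ :=
    RobustMarkovGame.exists_isHittingTimeBound_transitionMatrix hcompact hirr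
  have hfinite : U.robustDiameter ≤ ENNReal.ofReal H := by
    classical
    exact RobustMarkovGame.robustDiameter_le fun P hP =>
      ⟨fun i _ => stdSimplex.vertex (Classical.arbitrary (A i)), hbound P hP _⟩
  set D := U.robustDiameter.toReal
  refine ⟨ne_top_of_le_ne_top ENNReal.ofReal_ne_top hfinite, 1 + 2 * H / D, by positivity,
    fun r hr ε hε hεD π hπ => ?_⟩
  have hD : 0 < D := hε.trans_le hεD
  have hεD' : ε / D ≤ 1 := (div_le_one hD).2 hεD
  have hγ : 1 - ε / D ∈ Set.Ico (0 : ℝ) 1 := ⟨sub_nonneg.2 hεD', sub_lt_self 1 (div_pos hε hD)⟩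
  refine (hπ.isAverageNash hbound hγ hr).mono ?_
  calc (1 - (1 - ε / D)) * (ε + 2 * H) = ε / D * ε + 2 * H / D * ε := by ring
    _ ≤ 1 * ε + 2 * H / D * ε := by gcongr
    _ = (1 + 2 * H / D) * ε := by ring

theorem mainTheorem7 {ι S : Type*} [Fintype ι] [DecidableEq ι] [Fintype S] [DecidableEq S]
    [Nonempty S] {A : ι → Type*} [∀ i, Fintype (A i)] [∀ i, Nonempty (A i)]
    (U : RobustMarkovGame.UncertaintySet S A) (hU : U.IsRegular) :
    U.robustDiameter ≠ ⊤ ∧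
    ∃ C : ℝ, 0 < C ∧
      ∀ r : ι → S → RobustMarkovGame.JointAction A → ℝ,
        (∀ i s a, r i s a ∈ Set.Icc (0 : ℝ) 1) →
        ∀ ε : ℝ, 0 < ε → ε ≤ U.robustDiameter.toReal →
          ∀ π : RobustMarkovGame.JointPolicy S A,
            U.IsDiscountedNash r (1 - ε / U.robustDiameter.toReal) ε π →
            U.IsAverageNash r (C * ε) π :=
  mainTheorem7_general U hU.isCompact hU.irreducible
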